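/- **Definitions.** Let $n\ge 0$, $k\ge 1$, let $U\subset\mathbb R^n$ be open and let $\omega:U\to\Lambda^{k-1}(\mathbb R^n)^*$ be a $(k-1)$-form on $U$ (no regularity assumed). A *$k$-block* is a product $B=\prod_{i=1}^k[a_{i0},a_{i1}]\subset\mathbb R^k$ with $a_{i0}<a_{i1}$; $L(B)$ and $l(B)$ are the lengths of its longest and shortest sides. For a $(k-1)$-form $\eta$ defined on a neighbourhood of $B$ put $$\int_{\partial B}\eta=\sum_{i=1}^k\sum_{j=0}^1(-1)^{i+j}\int_{\prod_{l\ne i}[a_{l0},a_{l1}]}c_{ij}^*\eta,$$ where $c_{ij}$ inserts the constant $a_{ij}$ as the $i$-th coordinate and the integrals are Riemann integrals (evaluation at the point, if $k=1$); $\eta$ is *integrable over $\partial B$* if all these integrals exist. The form $\omega$ is *flux-integrable around $x\in U$* if for every open $A\subset\mathbb R^k$, every $C^1$ map $\varphi:A\to U$, every $p\in A$ with $\varphi(p)=x$ and every $k$-block $B\subset A$ with $p\in B$, the pullback $\varphi^*\omega$ is integrable over $\partial B$. The form $\omega$ is *derivable at $x\in U$ (in the flux sense)* if it is flux-integrable around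 $x$ and there is a $k$-form $\mathrm D\omega_x\in\Lambda^k(\mathbb R^n)^*$ such that for all $v_1,\dots,v_k\in\mathbb R^n$ and every $C^1$ map $\varphi:A\to U$ on an open set $A\subset\mathbb R^k$ with $p\in A$, $\varphi(p)=x$ and $\varphi'(p)e_i=v_i$ for $i=1,\dots,k$: for every $\varepsilon>0$ and every $K>1$ there is $\delta>0$ such that $$\left|\mathrm D\omega_x(v_1,\dots,v_k)-\frac1{\mathrm{vol}(B)}\int_{\partial B}\varphi^*\omega\right|<\varepsilon$$ for every $k$-block $B\subset A$ with $p\in B$, $L(B)<\delta$ and $L(B)/l(B)<K$. Such a $\mathrm D\omega_x$ is called an *exterior derivative of $\omega$ at $x$ in the flux sense*. If $\omega$ is (Fréchet) differentiable at $x$ with derivative $\omega'(x)$, its usual exterior derivative is $\mathrm d\omega_x(v_1,\dots,v_k)=\sum_{i=1}^k(-1)^{i+1}\,\omega'(x)v_i\,(v_1,\dots,\widehat{v_i},\dots,v_k)$. **Theorem ($\mathrm D=\mathrm d$ in the differentiable case).** Let $\omega$ be a $(k-1)$-form on an open set $U\subset\mathbb R^n$, and let $x_0\in U$. Suppose that $\omega$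 is flux-integrable around $x_0$ and differentiable at $x_0$. Then $\omega$ is derivable at $x_0$ in the flux sense, its exterior derivative $\mathrm D\omega_{x_0}$ in the flux sense is unique, and $$\mathrm D\omega_{x_0}=\mathrm d\omega_{x_0}.$$ -/

import Mathlib

open scoped Topology

noncomputable section

namespace Flux

/-- `ℝⁿ` with its Euclidean norm, the space in which forms live. -/
abbrev Eucl (n : ℕ) : Type := EuclideanSpace ℝ (Fin n)

/-- Differential `k`-forms on `V`, without any regularity assumption. A form on an open set `U`
is represented by a total function of which only the values on `U` are ever used. -/
abbrev Form (V : Type*) [NormedAddCommGroup V] [NormedSpace ℝ V] (k : ℕ) : Type _ :=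
  V → V [⋀^Fin k]→L[ℝ] ℝ

/-- The pullback `(φ^*ω)_t (w₁, …, w_k) = ω_{φ t} (φ'(t) w₁, …, φ'(t) w_k)`. -/
def pullback {V W : Type*} [NormedAddCommGroup V] [NormedSpace ℝ V]
    [NormedAddCommGroup W] [NormedSpace ℝ W] {k : ℕ} (φ : V → W) (ω : Form W k) : Form V k :=
  fun t => (ω (φ t)).compContinuousLinearMap (fderiv ℝ φ t)

/-- A `k`-block is a product of nondegenerate closed intervals `[a_i, b_i]`; it is represented by
its corners, that is by `B : BoxIntegral.Box (Fin k)`, the block itself being the set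
`BoxIntegral.Box.Icc B`. -/
abbrev Block (k : ℕ) : Type := BoxIntegral.Box (Fin k)

/-- The function `f` in `η = f dx¹ ∧ ⋯ ∧ dxᵏ`, for a `k`-form `η` on `ℝᵏ`. -/
def coeff {k : ℕ} (η : Form (Fin k → ℝ) k) (t : Fin k → ℝ) : ℝ :=
  η t (fun i => Pi.single i 1)

/-- Riemann integrability of a `k`-form over a `k`-block of `ℝᵏ`. -/
def BlockIntegrable {k : ℕ} (B : Block k) (η : Form (Fin k → ℝ) k) : Prop :=
  BoxIntegral.Integrable B BoxIntegral.IntegrationParams.Riemann (coeff η)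
    (MeasureTheory.volume : MeasureTheory.Measure (Fin k → ℝ)).toBoxAdditive.toSMul

/-- The Riemann integral of a `k`-form over a `k`-block of `ℝᵏ`. -/
def blockIntegral {k : ℕ} (B : Block k) (η : Form (Fin k → ℝ) k) : ℝ :=
  BoxIntegral.integral B BoxIntegral.IntegrationParams.Riemann (coeff η)
    (MeasureTheory.volume : MeasureTheory.Measure (Fin k → ℝ)).toBoxAdditive.toSMul

/-- The map `(t₁, …, t_m) ↦ (t₁, …, a, …, t_m)` with `a` inserted in position `i`. -/
def faceMap {m : ℕ} (i : Fin (m + 1)) (a : ℝ) (t : Fin m → ℝ) : Fin (m + 1) → ℝ :=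
  i.insertNth a t

/-- The `m`-form `η` on `ℝ^(m+1)` is integrable over the boundary of the block `B`: its pullback to
each of the `2(m+1)` faces is Riemann integrable. -/
def BoundaryIntegrable {m : ℕ} (B : Block (m + 1)) (η : Form (Fin (m + 1) → ℝ) m) : Prop :=
  ∀ i : Fin (m + 1),
    BlockIntegrable (B.face i) (pullback (faceMap i (B.lower i)) η) ∧
    BlockIntegrable (B.face i) (pullback (faceMap i (B.upper i)) η)

/-- The integral of the `m`-form `η` over the oriented boundary of `B`. Coordinates are numbered
from `0`, so the upper face (`j = 1`) in coordinate `i` has sign `(-1)^((i+1)+1) = (-1)^i`, and the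
lower face (`j = 0`) has the opposite sign. -/
def boundaryIntegral {m : ℕ} (B : Block (m + 1)) (η : Form (Fin (m + 1) → ℝ) m) : ℝ :=
  ∑ i : Fin (m + 1), (-1 : ℝ) ^ (i : ℕ) *
    (blockIntegral (B.face i) (pullback (faceMap i (B.upper i)) η) -
      blockIntegral (B.face i) (pullback (faceMap i (B.lower i)) η))

/-- The length of the longest side of `B`. -/
def longSide {m : ℕ} (B : Block (m + 1)) : ℝ := ⨆ i, (B.upper i - B.lower i)

/-- The length of the shortest side of `B`. -/
def shortSide {m : ℕ} (B : Block (m + 1)) : ℝ := ⨅ i, (B.upper i - B.lower i)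

/-- The volume of `B`. -/
def vol {m : ℕ} (B : Block (m + 1)) : ℝ := ∏ i, (B.upper i - B.lower i)

/-- `φ : A → U` is a `C¹` map on the open set `A`, with `p ∈ A` and `φ p = x`. -/
structure IsParamAt {n m : ℕ} (U : Set (Eucl n)) (x : Eucl n) (A : Set (Fin (m + 1) → ℝ))
    (φ : (Fin (m + 1) → ℝ) → Eucl n) (p : Fin (m + 1) → ℝ) : Prop where
  isOpen : IsOpen A
  contDiffOn : ContDiffOn ℝ 1 φ A
  mapsTo : Set.MapsTo φ A U
  mem : p ∈ A
  map_eq : φ p = x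

/-- Flux-integrability around `x` of the `m`-form `ω` on `U`: for every `C¹` map `φ : A → U` with
`φ p = x` and every block `B ⊆ A` containing `p`, the form `φ^*ω` is integrable over `∂B`. -/
def FluxIntegrableAt {n m : ℕ} (U : Set (Eucl n)) (ω : Form (Eucl n) m) (x : Eucl n) : Prop :=
  ∀ (A : Set (Fin (m + 1) → ℝ)) (φ : (Fin (m + 1) → ℝ) → Eucl n) (p : Fin (m + 1) → ℝ),
    IsParamAt U x A φ p →
    ∀ B : Block (m + 1), BoxIntegral.Box.Icc B ⊆ A → p ∈ BoxIntegral.Box.Icc B →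
      BoundaryIntegrable B (pullback φ ω)

/-- `g B → c` as the block `B ⊆ A` containing `p` shrinks to `p` with bounded eccentricity. -/
def BlockTendsto {m : ℕ} (A : Set (Fin (m + 1) → ℝ)) (p : Fin (m + 1) → ℝ)
    (g : Block (m + 1) → ℝ) (c : ℝ) : Prop :=
  ∀ ε : ℝ, 0 < ε → ∀ K : ℝ, 1 < K → ∃ δ : ℝ, 0 < δ ∧
    ∀ B : Block (m + 1), BoxIntegral.Box.Icc B ⊆ A → p ∈ BoxIntegral.Box.Icc B →
      longSide B < δ → longSide B / shortSide B < K → |c - g B| < ε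

/-- `η` is an exterior derivative of the `m`-form `ω` at `x` in the flux sense: `ω` is
flux-integrable around `x` and, for all `v`, `η (v)` is the limit of `vol(B)⁻¹ ∫_{∂B} φ^*ω` for
every `C¹` map `φ : A → U` with `φ p = x` and `φ'(p) e_i = v_i`. -/
def IsFluxDerivAt {n m : ℕ} (U : Set (Eucl n)) (ω : Form (Eucl n) m) (x : Eucl n)
    (η : Eucl n [⋀^Fin (m + 1)]→L[ℝ] ℝ) : Prop :=
  FluxIntegrableAt U ω x ∧
  ∀ (v : Fin (m + 1) → Eucl n) (A : Set (Fin (m + 1) → ℝ)) (φ : (Fin (m + 1) → ℝ) → Eucl n)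
    (p : Fin (m + 1) → ℝ), IsParamAt U x A φ p →
    (∀ i, fderiv ℝ φ p (Pi.single i 1) = v i) →
    BlockTendsto A p (fun B => (1 / vol B) * boundaryIntegral B (pullback φ ω)) (η v)

/-- `ω` is derivable at `x` in the flux sense. -/
def DerivableAt {n m : ℕ} (U : Set (Eucl n)) (ω : Form (Eucl n) m) (x : Eucl n) : Prop :=
  ∃ η : Eucl n [⋀^Fin (m + 1)]→L[ℝ] ℝ, IsFluxDerivAt U ω x η

end Flux

end

/-!
Write `ω = ω₀ + (ω - ω₀)` with `ω₀` the constant form `ω x₀`. A `C¹` map pulls the constant form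
back to a form with zero flux through the boundary of every block: for smooth `ψ` this is Stokes'
theorem and `d(ψ^*ω₀) = 0`, and on a block a `C¹` map is a `C¹` limit of smooth ones. The form
`ω - ω₀` vanishes at `x₀`, so its pullback by `φ` is differentiable at `p`, although `φ'` is merely
continuous there, and has exterior derivative `φ^*dω` at `p`.

For a form `η` differentiable at `p`, Stokes' theorem computes the flux of its affine part as
exactly `vol B * dη_p`. The remainder is `o(longSide B)` on `B`, and the faces of `B` have total
volume at most `2 (m + 1) vol B / shortSide B`, so bounded eccentricity makes the error `o(vol B)`.
Uniqueness follows from testing with affine maps on small cubes.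
-/

namespace Flux

open Set Filter MeasureTheory Asymptotics ContinuousAlternatingMap

section SmoothApproximation

open scoped ContDiff Convolution Manifold

variable {E F : Type*} [NormedAddCommGroup E] [NormedSpace ℝ E] [FiniteDimensional ℝ E]
  [NormedAddCommGroup F] [NormedSpace ℝ F]

theorem exists_contDiff_hasCompactSupport_eventuallyEq {n : ℕ∞} {A K : Set E} {φ : E → F}
    (hA : IsOpen A) (hφ : ContDiffOn ℝ n φ A) (hK : IsCompact K) (hKA : K ⊆ A) :
    ∃ g : E → F, ContDiff ℝ n g ∧ HasCompactSupport g ∧ g =ᶠ[𝓝ˢ K] φ := by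
  have := FiniteDimensional.proper_real E
  obtain ⟨L, hL, hKL, hLA⟩ := exists_compact_between hK hA hKA
  obtain ⟨χ, hχ_one, hχ_zero, -⟩ :=
    exists_contMDiffMap_one_nhds_of_subset_interior (n := n) 𝓘(ℝ, E) hK.isClosed hKL
  have hχ_supp : tsupport χ ⊆ L :=
    closure_minimal (Function.support_subset_iff'.2 hχ_zero) hL.isClosed
  have hg_supp : tsupport (fun x => χ x • φ x) ⊆ L :=
    (tsupport_smul_subset_left χ φ).trans hχ_supp
  refine ⟨fun x => χ x • φ x, contDiff_iff_contDiffAt.2 fun x => ?_,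
    hL.of_isClosed_subset (isClosed_tsupport _) hg_supp,
    hχ_one.mono fun x hx => by simp [hx]⟩
  by_cases hx : x ∈ A
  · exact χ.contMDiff.contDiff.contDiffAt.smul (hφ.contDiffAt (hA.mem_nhds hx))
  · exact contDiffAt_const.congr_of_eventuallyEq
      (notMem_tsupport_iff_eventuallyEq.1 fun h => hx (hLA (hg_supp h)))

variable [CompleteSpace F]

theorem exists_contDiff_dist_fderiv_le {g : E → F} (hg : ContDiff ℝ 1 g)
    (hsupp : HasCompactSupport g) {ε : ℝ} (hε : 0 < ε) :
    ∃ ψ : E → F, ContDiff ℝ ∞ ψ ∧ ∀ x, dist (fderiv ℝ ψ x) (fderiv ℝ g x) ≤ ε := by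
  have hg' : Continuous (fderiv ℝ g) := hg.continuous_fderiv one_ne_zero
  obtain ⟨δ, hδ, hgδ⟩ := Metric.uniformContinuous_iff.1
    ((hsupp.fderiv ℝ).uniformContinuous_of_continuous hg') ε hε
  borelize E
  let μ : Measure E := Measure.addHaar
  let b : ContDiffBump (0 : E) := ⟨δ / 2, δ, half_pos hδ, half_lt_self hδ⟩
  have hb : LocallyIntegrable (b.normed μ) μ :=
    (b.contDiff_normed (n := 0)).continuous.locallyIntegrable
  refine ⟨b.normed μ ⋆[ContinuousLinearMap.lsmul ℝ ℝ, μ] g,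
    b.hasCompactSupport_normed.contDiff_convolution_left _ b.contDiff_normed
      hg.continuous.locallyIntegrable, fun x => ?_⟩
  rw [(hsupp.hasFDerivAt_convolution_right _ hb hg x).fderiv]
  exact b.dist_normed_convolution_le hg'.aestronglyMeasurable fun y hy => (hgδ hy).le

theorem exists_contDiff_dist_fderiv_le_of_isCompact {A K : Set E} {φ : E → F} (hA : IsOpen A)
    (hφ : ContDiffOn ℝ 1 φ A) (hK : IsCompact K) (hKA : K ⊆ A) {ε : ℝ} (hε : 0 < ε) :
    ∃ ψ : E → F, ContDiff ℝ ∞ ψ ∧ ∀ x ∈ K, dist (fderiv ℝ ψ x) (fderiv ℝ φ x) ≤ ε := by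
  obtain ⟨g, hg, hsupp, hgφ⟩ :=
    exists_contDiff_hasCompactSupport_eventuallyEq (n := 1) hA hφ hK hKA
  obtain ⟨ψ, hψ, hψg⟩ := exists_contDiff_dist_fderiv_le hg hsupp hε
  refine ⟨ψ, hψ, fun x hx => ?_⟩
  rw [← (hgφ.filter_mono (nhds_le_nhdsSet hx)).fderiv_eq]
  exact hψg x

end SmoothApproximation

section Pullback

variable {V W X Y : Type*} [NormedAddCommGroup V] [NormedSpace ℝ V] [NormedAddCommGroup W]
  [NormedSpace ℝ W] [NormedAddCommGroup X] [NormedSpace ℝ X] [NormedAddCommGroup Y]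
  [NormedSpace ℝ Y] {k : ℕ}

theorem pullback_sub (φ : V → W) (ω ω' : Form W k) :
    pullback φ (ω - ω') = pullback φ ω - pullback φ ω' := rfl

theorem continuous_compContinuousLinearMap_right (α : W [⋀^Fin k]→L[ℝ] ℝ) :
    Continuous fun T : V →L[ℝ] W => α.compContinuousLinearMap T :=
  (ContinuousLinearMap.apply ℝ _ α).continuous.comp continuous_compContinuousLinearMapCLM

theorem continuousOn_pullback_const {φ : V → W} {s : Set V} (hφ : ContinuousOn (fderiv ℝ φ) s)
    (α : W [⋀^Fin k]→L[ℝ] ℝ) : ContinuousOn (pullback φ fun _ => α) s :=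
  (continuous_compContinuousLinearMap_right α).comp_continuousOn hφ

theorem differentiable_pullback_const {φ : V → W} (hφ : ContDiff ℝ 2 φ)
    (α : W [⋀^Fin k]→L[ℝ] ℝ) : Differentiable ℝ (pullback φ fun _ => α) := fun s =>
  (differentiableAt_const α).continuousAlternatingMapCompContinuousLinearMap
    ((hφ.fderiv_right (m := 1) (by norm_num)).differentiable one_ne_zero s)

theorem extDeriv_pullback_const {φ : V → W} {s : V} (hφ : ContDiffAt ℝ 2 φ s)
    (α : W [⋀^Fin k]→L[ℝ] ℝ) : extDeriv (pullback φ fun _ => α) s = 0 := by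
  refine (extDeriv_pullback (differentiableAt_const α) hφ (by simp)).trans ?_
  ext v
  simp [extDeriv_apply]

open scoped ContDiff in
theorem exists_contDiff_norm_pullback_const_sub_le [FiniteDimensional ℝ V] [CompleteSpace W]
    {A K : Set V} {φ : V → W} (hA : IsOpen A) (hφ : ContDiffOn ℝ 1 φ A) (hK : IsCompact K)
    (hKA : K ⊆ A) (α : W [⋀^Fin k]→L[ℝ] ℝ) {r : ℝ} (hr : 0 < r) :
    ∃ ψ : V → W, ContDiff ℝ ∞ ψ ∧
      ∀ s ∈ K, ‖(pullback φ (fun _ => α) - pullback ψ fun _ => α) s‖ ≤ r := by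
  have hφ' : ContinuousOn (fderiv ℝ φ) K :=
    (hφ.continuousOn_fderiv_of_isOpen hA le_rfl).mono hKA
  have huniform := (hK.image_of_continuousOn hφ').uniformContinuousAt_of_continuousAt
    (fun T : V →L[ℝ] W => α.compContinuousLinearMap T)
    (fun _ _ => (continuous_compContinuousLinearMap_right α).continuousAt)
    (Metric.dist_mem_uniformity hr)
  obtain ⟨ε, hε, hεr⟩ := Metric.mem_uniformity_dist.1 huniform
  obtain ⟨ψ, hψ, hψφ⟩ := exists_contDiff_dist_fderiv_le_of_isCompact hA hφ hK hKA (half_pos hε)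
  refine ⟨ψ, hψ, fun s hs => ?_⟩
  have hclose : dist (fderiv ℝ φ s) (fderiv ℝ ψ s) < ε :=
    (dist_comm _ _).trans_lt ((hψφ s hs).trans_lt (half_lt_self hε))
  exact (dist_eq_norm (α.compContinuousLinearMap (fderiv ℝ φ s)) _).symm.trans_le
    (hεr hclose (mem_image_of_mem _ hs)).le

theorem hasFDerivAt_clm_apply_of_eq_zero {f : V → X} {D : V →L[ℝ] X} {G : V → X →L[ℝ] Y} {p : V}
    (hf : HasFDerivAt f D p) (hfp : f p = 0) (hG : ContinuousAt G p) :
    HasFDerivAt (fun s => G s (f s)) (G p ∘L D) p := by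
  have hfrozen : (fun s => G p (f s) - G p (D (s - p))) =o[𝓝 p] fun s => s - p := by
    simpa [hfp] using ((G p).hasFDerivAt.comp p hf).isLittleO
  have hG_sub : (fun s => ‖G s - G p‖) =o[𝓝 p] fun _ => (1 : ℝ) :=
    (isLittleO_one_iff ℝ).2 (tendsto_iff_norm_sub_tendsto_zero.1 hG)
  have hf_bigO : f =O[𝓝 p] fun s => s - p := by simpa [hfp] using hf.isBigO_sub
  have hvariation : (fun s => (G s - G p) (f s)) =o[𝓝 p] fun s => s - p := by
    refine (isBoundedBilinearMap_apply.isBigO_comp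
      (g := fun s => G s - G p) (h := f)).trans_isLittleO ?_
    simpa using hG_sub.mul_isBigO hf_bigO.norm_norm
  refine .of_isLittleO ((hfrozen.add hvariation).congr_left fun s => ?_)
  simp [hfp]

variable {φ : V → W} {ω : Form W k} {p : V}

theorem hasFDerivAt_pullback_of_eq_zero (hω : DifferentiableAt ℝ ω (φ p)) (hωp : ω (φ p) = 0)
    (hφ : ContDiffAt ℝ 1 φ p) :
    HasFDerivAt (pullback φ ω)
      (compContinuousLinearMapCLM (fderiv ℝ φ p) ∘L fderiv ℝ ω (φ p) ∘L fderiv ℝ φ p) p :=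
  hasFDerivAt_clm_apply_of_eq_zero
    (hω.hasFDerivAt.comp p (hφ.differentiableAt one_ne_zero).hasFDerivAt) hωp
    (continuous_compContinuousLinearMapCLM.continuousAt.comp
      (hφ.fderiv_right (m := 0) le_rfl).continuousAt)

theorem extDeriv_pullback_of_eq_zero (hω : DifferentiableAt ℝ ω (φ p)) (hωp : ω (φ p) = 0)
    (hφ : ContDiffAt ℝ 1 φ p) :
    extDeriv (pullback φ ω) p =
      (extDeriv ω (φ p)).compContinuousLinearMap (fderiv ℝ φ p) := by
  ext v
  rw [extDeriv, (hasFDerivAt_pullback_of_eq_zero hω hωp hφ).fderiv,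
    compContinuousLinearMap_apply, extDeriv, alternatizeUncurryFin_apply,
    alternatizeUncurryFin_apply]
  rfl

end Pullback

/-- The standard basis `e₁, …, e_k` of `ℝᵏ`, on which `coeff` evaluates a `k`-form. -/
abbrev stdFrame (k : ℕ) : Fin k → Fin k → ℝ := fun i => Pi.single i 1

section Sides

variable {m : ℕ} {B : Block (m + 1)}

theorem side_pos (B : Block (m + 1)) (i : Fin (m + 1)) : 0 < B.upper i - B.lower i :=
  sub_pos.2 (B.lower_lt_upper i)

theorem side_le_longSide (B : Block (m + 1)) (i : Fin (m + 1)) :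
    B.upper i - B.lower i ≤ longSide B :=
  le_ciSup (f := fun i => B.upper i - B.lower i) (finite_range _).bddAbove i

theorem shortSide_le_side (B : Block (m + 1)) (i : Fin (m + 1)) :
    shortSide B ≤ B.upper i - B.lower i :=
  ciInf_le (f := fun i => B.upper i - B.lower i) (finite_range _).bddBelow i

theorem longSide_pos (B : Block (m + 1)) : 0 < longSide B :=
  (side_pos B 0).trans_le (side_le_longSide B 0)

theorem shortSide_pos (B : Block (m + 1)) : 0 < shortSide B := by
  obtain ⟨i, hi⟩ := exists_eq_ciInf_of_finite (f := fun i => B.upper i - B.lower i)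
  exact (side_pos B i).trans_eq hi

theorem vol_pos (B : Block (m + 1)) : 0 < vol B := Finset.prod_pos fun i _ => side_pos B i

theorem norm_sub_le_longSide {s p : Fin (m + 1) → ℝ} (hs : s ∈ BoxIntegral.Box.Icc B)
    (hp : p ∈ BoxIntegral.Box.Icc B) : ‖s - p‖ ≤ longSide B := by
  refine (pi_norm_le_iff_of_nonempty _).2 fun i => le_trans ?_ (side_le_longSide B i)
  rw [Pi.sub_apply, Real.norm_eq_abs, abs_le]
  constructor <;> linarith [hs.1 i, hs.2 i, hp.1 i, hp.2 i]

/-- The total `m`-dimensional volume of the `2 (m + 1)` faces of `B`, which controls boundary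
integrals of bounded forms. Opposite faces are congruent, hence the factor `2`. -/
def boundaryVol (B : Block (m + 1)) : ℝ :=
  ∑ i, 2 * ∏ j, ((B.face i).upper j - (B.face i).lower j)

theorem vol_face_le (B : Block (m + 1)) (i : Fin (m + 1)) :
    ∏ j, ((B.face i).upper j - (B.face i).lower j) ≤ vol B / shortSide B := by
  rw [le_div_iff₀ (shortSide_pos B), vol, ← BoxIntegral.Box.volume_face_mul i B]
  exact mul_le_mul_of_nonneg_left (shortSide_le_side B i)
    (Finset.prod_nonneg fun j _ => sub_nonneg.2 ((B.face i).lower_le_upper j))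

theorem boundaryVol_le (B : Block (m + 1)) :
    boundaryVol B ≤ 2 * (m + 1) * (vol B / shortSide B) := by
  calc boundaryVol B ≤ ∑ _i : Fin (m + 1), 2 * (vol B / shortSide B) :=
        Finset.sum_le_sum fun i _ => mul_le_mul_of_nonneg_left (vol_face_le B i) zero_le_two
    _ = 2 * (m + 1) * (vol B / shortSide B) := by
        rw [Finset.sum_const, Finset.card_fin, nsmul_eq_mul]
        push_cast
        ring

theorem exists_cube_subset {A : Set (Fin (m + 1) → ℝ)} {p : Fin (m + 1) → ℝ} (hA : A ∈ 𝓝 p)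
    {δ : ℝ} (hδ : 0 < δ) : ∃ B : Block (m + 1), BoxIntegral.Box.Icc B ⊆ A ∧
      p ∈ BoxIntegral.Box.Icc B ∧ longSide B < δ ∧ longSide B / shortSide B = 1 := by
  obtain ⟨r, hr, hrA⟩ := Metric.nhds_basis_closedBall.mem_iff.1 hA
  let d := min r (δ / 2)
  have hd : 0 < d := lt_min hr (half_pos hδ)
  let B : Block (m + 1) := ⟨p, fun i => p i + d, fun i => lt_add_of_pos_right _ hd⟩
  have hside (i) : B.upper i - B.lower i = d := add_sub_cancel_left _ _
  have hlong : longSide B = d := by simp [longSide, hside]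
  have hshort : shortSide B = d := by simp [shortSide, hside]
  have hp : p ∈ BoxIntegral.Box.Icc B := B.lower_mem_Icc
  refine ⟨B, fun s hs => hrA ?_, hp, ?_, ?_⟩
  · rw [mem_closedBall_iff_norm]
    exact (norm_sub_le_longSide hs hp).trans (hlong.trans_le (min_le_left _ _))
  · rw [hlong]
    exact (min_le_right _ _).trans_lt (half_lt_self hδ)
  · rw [hlong, hshort, div_self hd.ne']

theorem BlockTendsto.unique {A : Set (Fin (m + 1) → ℝ)} {p : Fin (m + 1) → ℝ} (hA : A ∈ 𝓝 p)
    {g : Block (m + 1) → ℝ} {a b : ℝ} (ha : BlockTendsto A p g a) (hb : BlockTendsto A p g b) :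
    a = b := by
  refine eq_of_forall_dist_le fun ε hε => ?_
  obtain ⟨δ, hδ, hag⟩ := ha (ε / 2) (half_pos hε) 2 one_lt_two
  obtain ⟨δ', hδ', hbg⟩ := hb (ε / 2) (half_pos hε) 2 one_lt_two
  obtain ⟨B, hBA, hpB, hlong, hratio⟩ := exists_cube_subset hA (lt_min hδ hδ')
  have hag := hag B hBA hpB (hlong.trans_le (min_le_left _ _)) (hratio.trans_lt one_lt_two)
  have hbg := hbg B hBA hpB (hlong.trans_le (min_le_right _ _)) (hratio.trans_lt one_lt_two)
  rw [← Real.dist_eq] at hag hbg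
  linarith [dist_triangle_right a b (g B)]

end Sides

section Boundary

variable {m : ℕ} {B : Block (m + 1)} {η η' : Form (Fin (m + 1) → ℝ) m}

theorem hasFDerivAt_faceMap (i : Fin (m + 1)) (a : ℝ) (t : Fin m → ℝ) :
    HasFDerivAt (faceMap i a)
      (ContinuousLinearMap.pi (i.insertNth (α := fun _ => (Fin m → ℝ) →L[ℝ] ℝ) 0
        fun j => ContinuousLinearMap.proj j)) t := by
  rw [hasFDerivAt_pi']
  intro j
  cases j using i.succAboveCases with
  | x =>
    simp only [faceMap, Fin.insertNth_apply_same]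
    exact (hasFDerivAt_const a t).congr_fderiv (by ext; simp)
  | p j =>
    simp only [faceMap, Fin.insertNth_apply_succAbove]
    exact (hasFDerivAt_apply j t).congr_fderiv (by ext; simp)

theorem fderiv_faceMap_single (i : Fin (m + 1)) (a : ℝ) (t : Fin m → ℝ) (j : Fin m) :
    fderiv ℝ (faceMap i a) t (Pi.single j 1) = Pi.single (i.succAbove j) 1 := by
  rw [(hasFDerivAt_faceMap i a t).fderiv]
  ext l
  cases l using i.succAboveCases <;> simp [Pi.single_apply]

theorem coeff_pullback_faceMap (i : Fin (m + 1)) (a : ℝ) (η : Form (Fin (m + 1) → ℝ) m) :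
    coeff (pullback (faceMap i a) η) = fun t =>
      η (i.insertNth a t) (i.removeNth (stdFrame (m + 1))) := by
  ext t
  simp only [coeff, pullback, compContinuousLinearMap_apply]
  congr 1
  ext1 j
  simp [Fin.removeNth, fderiv_faceMap_single]

theorem continuousOn_coeff_pullback_faceMap (hη : ContinuousOn η (BoxIntegral.Box.Icc B))
    (i : Fin (m + 1)) {a : ℝ} (ha : a ∈ Icc (B.lower i) (B.upper i)) :
    ContinuousOn (coeff (pullback (faceMap i a) η)) (BoxIntegral.Box.Icc (B.face i)) := by
  rw [coeff_pullback_faceMap]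
  exact (apply ℝ _ ℝ (i.removeNth (stdFrame (m + 1)))).continuous.comp_continuousOn
    (B.continuousOn_face_Icc hη ha)

theorem BoundaryIntegrable.of_continuousOn (hη : ContinuousOn η (BoxIntegral.Box.Icc B)) :
    BoundaryIntegrable B η := by
  have hface (i : Fin (m + 1)) {a : ℝ} (ha : a ∈ Icc (B.lower i) (B.upper i)) :
      BlockIntegrable (B.face i) (pullback (faceMap i a) η) :=
    BoxIntegral.integrable_of_continuousOn _ (continuousOn_coeff_pullback_faceMap hη i ha) _
  exact fun i => ⟨hface i (left_mem_Icc.2 (B.lower_le_upper i)),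
    hface i (right_mem_Icc.2 (B.lower_le_upper i))⟩

theorem BoundaryIntegrable.sub (h : BoundaryIntegrable B η) (h' : BoundaryIntegrable B η') :
    BoundaryIntegrable B (η - η') :=
  fun i => ⟨(h i).1.sub (h' i).1, (h i).2.sub (h' i).2⟩

theorem blockIntegral_pullback_faceMap_sub {i : Fin (m + 1)} {a : ℝ}
    (h : BlockIntegrable (B.face i) (pullback (faceMap i a) η))
    (h' : BlockIntegrable (B.face i) (pullback (faceMap i a) η')) :
    blockIntegral (B.face i) (pullback (faceMap i a) (η - η')) =
      blockIntegral (B.face i) (pullback (faceMap i a) η) -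
        blockIntegral (B.face i) (pullback (faceMap i a) η') :=
  BoxIntegral.integral_sub h h'

theorem boundaryIntegral_sub (h : BoundaryIntegrable B η) (h' : BoundaryIntegrable B η') :
    boundaryIntegral B (η - η') = boundaryIntegral B η - boundaryIntegral B η' := by
  simp only [boundaryIntegral, ← Finset.sum_sub_distrib]
  refine Finset.sum_congr rfl fun i _ => ?_
  rw [blockIntegral_pullback_faceMap_sub (h i).1 (h' i).1,
    blockIntegral_pullback_faceMap_sub (h i).2 (h' i).2]
  ring

theorem abs_boundaryIntegral_le {c : ℝ} (h : ∀ s ∈ BoxIntegral.Box.Icc B, ‖η s‖ ≤ c) :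
    |boundaryIntegral B η| ≤ c * boundaryVol B := by
  have hface (i : Fin (m + 1)) {a : ℝ} (ha : a ∈ Icc (B.lower i) (B.upper i)) :
      |blockIntegral (B.face i) (pullback (faceMap i a) η)| ≤
        c * ∏ j, ((B.face i).upper j - (B.face i).lower j) := by
    rw [← BoxIntegral.Box.volume_apply', mul_comm]
    refine BoxIntegral.norm_integral_le_of_le_const (E := ℝ) (fun t ht => ?_)
      (volume : Measure (Fin m → ℝ))
    rw [coeff_pullback_faceMap]
    refine (le_opNorm _ _).trans ?_
    simpa [Fin.removeNth, Pi.norm_single] using h _ (B.mapsTo_insertNth_face_Icc ha ht)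
  rw [boundaryVol, Finset.mul_sum]
  refine (Finset.abs_sum_le_sum_abs _ _).trans (Finset.sum_le_sum fun i _ => ?_)
  rw [abs_mul, abs_pow, abs_neg, abs_one, one_pow, one_mul, mul_left_comm, two_mul]
  exact (abs_sub _ _).trans (add_le_add (hface i (right_mem_Icc.2 (B.lower_le_upper i)))
    (hface i (left_mem_Icc.2 (B.lower_le_upper i))))

end Boundary

section Stokes

variable {m : ℕ} {B : Block (m + 1)} {η : Form (Fin (m + 1) → ℝ) m}

theorem blockIntegral_eq_setIntegral {k : ℕ} {B : Block k} {η : Form (Fin k → ℝ) k}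
    (hη : ContinuousOn (coeff η) (BoxIntegral.Box.Icc B)) :
    blockIntegral B η = ∫ t in BoxIntegral.Box.Icc B, coeff η t := by
  rw [blockIntegral, ← setIntegral_congr_set B.coe_ae_eq_Icc]
  exact (ContinuousOn.hasBoxIntegral (volume : Measure (Fin k → ℝ)) hη
    BoxIntegral.IntegrationParams.Riemann).integral_eq

theorem blockIntegral_pullback_faceMap (hη : ContinuousOn η (BoxIntegral.Box.Icc B))
    (i : Fin (m + 1)) {a : ℝ} (ha : a ∈ Icc (B.lower i) (B.upper i)) :
    blockIntegral (B.face i) (pullback (faceMap i a) η) =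
      ∫ t in BoxIntegral.Box.Icc (B.face i),
        η (i.insertNth a t) (i.removeNth (stdFrame (m + 1))) := by
  rw [blockIntegral_eq_setIntegral (continuousOn_coeff_pullback_faceMap hη i ha),
    coeff_pullback_faceMap]

theorem boundaryIntegral_eq_integral_extDeriv (hη : Differentiable ℝ η)
    (hint : IntegrableOn (coeff (extDeriv η)) (BoxIntegral.Box.Icc B)) :
    boundaryIntegral B η = ∫ s in BoxIntegral.Box.Icc B, coeff (extDeriv η) s := by
  let f : Fin (m + 1) → (Fin (m + 1) → ℝ) → ℝ := fun i s =>
    (-1 : ℝ) ^ (i : ℕ) * η s (i.removeNth (stdFrame (m + 1)))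
  have hη_apply (i : Fin (m + 1)) :
      Differentiable ℝ fun s => η s (i.removeNth (stdFrame (m + 1))) :=
    (apply ℝ _ ℝ (i.removeNth (stdFrame (m + 1)))).differentiable.comp hη
  have hf (i) : Differentiable ℝ (f i) := (hη_apply i).const_mul _
  have hdiv : coeff (extDeriv η) = fun s => ∑ i, fderiv ℝ (f i) s (Pi.single i 1) := by
    ext s
    rw [coeff, extDeriv_apply (hη s)]
    refine Finset.sum_congr rfl fun i _ => ?_
    simp [f, fderiv_const_mul (hη_apply i s), zsmul_eq_mul]
  have hη_cont : ContinuousOn η (BoxIntegral.Box.Icc B) := hη.continuous.continuousOn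
  rw [hdiv] at hint ⊢
  refine .trans ?_ (integral_divergence_of_hasFDerivAt_off_countable' B.lower B.upper
    B.lower_le_upper f (fun i => fderiv ℝ (f i)) ∅ countable_empty
    (fun i => (hf i).continuous.continuousOn) (fun s _ i => (hf i s).hasFDerivAt) hint).symm
  refine Finset.sum_congr rfl fun i _ => ?_
  rw [blockIntegral_pullback_faceMap hη_cont i (right_mem_Icc.2 (B.lower_le_upper i)),
    blockIntegral_pullback_faceMap hη_cont i (left_mem_Icc.2 (B.lower_le_upper i)), mul_sub]
  simp only [f, integral_const_mul]
  rfl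

theorem boundaryIntegral_of_coeff_extDeriv_eq_const (hη : Differentiable ℝ η) {c : ℝ}
    (hc : ∀ s, coeff (extDeriv η) s = c) : boundaryIntegral B η = vol B * c := by
  have hc' : coeff (extDeriv η) = fun _ => c := funext hc
  rw [boundaryIntegral_eq_integral_extDeriv hη, hc', setIntegral_const,
    ← measureReal_congr B.coe_ae_eq_Icc, measureReal_def, BoxIntegral.Box.volume_apply',
    smul_eq_mul, vol]
  rw [hc']
  exact integrableOn_const (B.measure_Icc_lt_top volume).ne

theorem boundaryIntegral_affine (B : Block (m + 1)) (η₀ : (Fin (m + 1) → ℝ) [⋀^Fin m]→L[ℝ] ℝ)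
    (L : (Fin (m + 1) → ℝ) →L[ℝ] (Fin (m + 1) → ℝ) [⋀^Fin m]→L[ℝ] ℝ) (p : Fin (m + 1) → ℝ) :
    boundaryIntegral B (fun s => η₀ + L (s - p)) =
      vol B * alternatizeUncurryFin L (stdFrame (m + 1)) := by
  have hderiv (s) : HasFDerivAt (fun s => η₀ + L (s - p)) L s :=
    (L.hasFDerivAt.comp s ((hasFDerivAt_id s).sub_const p)).const_add η₀
  refine boundaryIntegral_of_coeff_extDeriv_eq_const
    (fun s => (hderiv s).differentiableAt) fun s => ?_
  rw [coeff, extDeriv, (hderiv s).fderiv]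

theorem boundaryIntegral_pullback_const {W : Type*} [NormedAddCommGroup W] [NormedSpace ℝ W]
    [CompleteSpace W] {A : Set (Fin (m + 1) → ℝ)} {φ : (Fin (m + 1) → ℝ) → W} (hA : IsOpen A)
    (hφ : ContDiffOn ℝ 1 φ A) (hBA : BoxIntegral.Box.Icc B ⊆ A) (α : W [⋀^Fin m]→L[ℝ] ℝ) :
    boundaryIntegral B (pullback φ fun _ => α) = 0 := by
  have hφ_int : BoundaryIntegrable B (pullback φ fun _ => α) := .of_continuousOn
    (continuousOn_pullback_const ((hφ.continuousOn_fderiv_of_isOpen hA le_rfl).mono hBA) α)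
  have hsmall : ∀ r > 0, |boundaryIntegral B (pullback φ fun _ => α)| ≤ r * boundaryVol B := by
    intro r hr
    obtain ⟨ψ, hψ, hψφ⟩ :=
      exists_contDiff_norm_pullback_const_sub_le hA hφ B.isCompact_Icc hBA α hr
    have hψ_two : ContDiff ℝ 2 ψ := hψ.of_le (WithTop.coe_le_coe.2 le_top)
    have hψ_diff := differentiable_pullback_const hψ_two α
    have hψ_zero : boundaryIntegral B (pullback ψ fun _ => α) = 0 := by
      have hψ_coeff (s) : coeff (extDeriv (pullback ψ fun _ => α)) s = 0 := by
        rw [coeff, extDeriv_pullback_const hψ_two.contDiffAt]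
        rfl
      rw [boundaryIntegral_of_coeff_extDeriv_eq_const hψ_diff hψ_coeff, mul_zero]
    simpa only [boundaryIntegral_sub hφ_int (.of_continuousOn hψ_diff.continuous.continuousOn),
      hψ_zero, sub_zero] using abs_boundaryIntegral_le hψφ
  have hlim : Tendsto (fun r => r * boundaryVol B) (𝓝[>] 0) (𝓝 0) := by
    simpa using (tendsto_id.mul_const (boundaryVol B)).mono_left (nhdsWithin_le_nhds (a := (0 : ℝ)))
  exact abs_nonpos_iff.1 (ge_of_tendsto hlim (eventually_mem_nhdsWithin.mono hsmall))

end Stokes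

section FluxDerivative

variable {m : ℕ} {A : Set (Fin (m + 1) → ℝ)} {p : Fin (m + 1) → ℝ}

theorem abs_boundaryIntegral_sub_vol_mul_le {B : Block (m + 1)} {η : Form (Fin (m + 1) → ℝ) m}
    (hη : BoundaryIntegrable B η) (η₀ : (Fin (m + 1) → ℝ) [⋀^Fin m]→L[ℝ] ℝ)
    (L : (Fin (m + 1) → ℝ) →L[ℝ] (Fin (m + 1) → ℝ) [⋀^Fin m]→L[ℝ] ℝ) {c : ℝ}
    (hc : ∀ s ∈ BoxIntegral.Box.Icc B, ‖η s - (η₀ + L (s - p))‖ ≤ c) :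
    |boundaryIntegral B η - vol B * alternatizeUncurryFin L (stdFrame (m + 1))| ≤
      c * boundaryVol B := by
  have haffine : BoundaryIntegrable B (fun s => η₀ + L (s - p)) :=
    .of_continuousOn (by fun_prop)
  rw [← boundaryIntegral_affine B η₀ L p, ← boundaryIntegral_sub hη haffine]
  exact abs_boundaryIntegral_le hc

theorem blockTendsto_boundaryIntegral_of_differentiableAt {η : Form (Fin (m + 1) → ℝ) m}
    (hint : ∀ B : Block (m + 1), BoxIntegral.Box.Icc B ⊆ A → p ∈ BoxIntegral.Box.Icc B →
      BoundaryIntegrable B η)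
    (hη : DifferentiableAt ℝ η p) :
    BlockTendsto A p (fun B => 1 / vol B * boundaryIntegral B η) (coeff (extDeriv η) p) := by
  intro ε hε K hK
  let r : ℝ := ε / (2 * (m + 1) * K)
  have hr : 0 < r := by positivity
  obtain ⟨δ, hδ, hδr⟩ := Metric.eventually_nhds_iff.1 (hη.hasFDerivAt.isLittleO.def hr)
  refine ⟨δ, hδ, fun B hBA hpB hlong hratio => ?_⟩
  have hremainder : ∀ s ∈ BoxIntegral.Box.Icc B,
      ‖η s - (η p + fderiv ℝ η p (s - p))‖ ≤ r * longSide B := by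
    intro s hs
    have hsp := norm_sub_le_longSide hs hpB
    rw [← sub_sub]
    exact (hδr ((dist_eq_norm s p).trans_lt (hsp.trans_lt hlong))).trans
      (mul_le_mul_of_nonneg_left hsp hr.le)
  have hvol := vol_pos B
  have herror : |boundaryIntegral B η - vol B * coeff (extDeriv η) p| < ε * vol B := by
    calc |boundaryIntegral B η - vol B * coeff (extDeriv η) p|
        ≤ r * longSide B * boundaryVol B :=
          abs_boundaryIntegral_sub_vol_mul_le (hint B hBA hpB) _ _ hremainder
      _ ≤ r * longSide B * (2 * (m + 1) * (vol B / shortSide B)) :=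
          mul_le_mul_of_nonneg_left (boundaryVol_le B) (mul_pos hr (longSide_pos B)).le
      _ = 2 * (m + 1) * r * vol B * (longSide B / shortSide B) := by ring
      _ < 2 * (m + 1) * r * vol B * K := by gcongr
      _ = ε * vol B := by simp only [r]; field_simp
  have hquotient : coeff (extDeriv η) p - 1 / vol B * boundaryIntegral B η =
      -((boundaryIntegral B η - vol B * coeff (extDeriv η) p) / vol B) := by
    field_simp
    ring
  rwa [hquotient, abs_neg, abs_div, abs_of_pos hvol, div_lt_iff₀ hvol]

theorem blockTendsto_boundaryIntegral_pullback {W : Type*} [NormedAddCommGroup W]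
    [NormedSpace ℝ W] [CompleteSpace W] {φ : (Fin (m + 1) → ℝ) → W} {ω : Form W m}
    (hA : IsOpen A) (hφ : ContDiffOn ℝ 1 φ A) (hp : p ∈ A)
    (hint : ∀ B : Block (m + 1), BoxIntegral.Box.Icc B ⊆ A → p ∈ BoxIntegral.Box.Icc B →
      BoundaryIntegrable B (pullback φ ω))
    (hω : DifferentiableAt ℝ ω (φ p)) :
    BlockTendsto A p (fun B => 1 / vol B * boundaryIntegral B (pullback φ ω))
      (extDeriv ω (φ p) (fderiv ℝ φ p ∘ stdFrame (m + 1))) := by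
  let ω₀ : Form W m := fun _ => ω (φ p)
  have hφp : ContDiffAt ℝ 1 φ p := hφ.contDiffAt (hA.mem_nhds hp)
  have hdiff : DifferentiableAt ℝ (ω - ω₀) (φ p) := hω.sub_const _
  have hzero : (ω - ω₀) (φ p) = 0 := sub_self _
  have hconst_int (B : Block (m + 1)) (hBA : BoxIntegral.Box.Icc B ⊆ A) :
      BoundaryIntegrable B (pullback φ ω₀) := .of_continuousOn
    (continuousOn_pullback_const ((hφ.continuousOn_fderiv_of_isOpen hA le_rfl).mono hBA) _)
  have hboundary (B : Block (m + 1)) (hBA : BoxIntegral.Box.Icc B ⊆ A)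
      (hpB : p ∈ BoxIntegral.Box.Icc B) :
      boundaryIntegral B (pullback φ (ω - ω₀)) = boundaryIntegral B (pullback φ ω) := by
    rw [pullback_sub, boundaryIntegral_sub (hint B hBA hpB) (hconst_int B hBA),
      boundaryIntegral_pullback_const hA hφ hBA, sub_zero]
  have hextDeriv : coeff (extDeriv (pullback φ (ω - ω₀))) p =
      extDeriv ω (φ p) (fderiv ℝ φ p ∘ stdFrame (m + 1)) := by
    rw [coeff, extDeriv_pullback_of_eq_zero hdiff hzero hφp, compContinuousLinearMap_apply,
      extDeriv, extDeriv, show fderiv ℝ (ω - ω₀) (φ p) = _ from fderiv_sub_const _]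
  have hlim := blockTendsto_boundaryIntegral_of_differentiableAt (A := A)
    (fun B hBA hpB => (hint B hBA hpB).sub (hconst_int B hBA))
    (hasFDerivAt_pullback_of_eq_zero hdiff hzero hφp).differentiableAt
  intro ε hε K hK
  obtain ⟨δ, hδ, hclose⟩ := hlim ε hε K hK
  refine ⟨δ, hδ, fun B hBA hpB hlong hratio => ?_⟩
  simpa only [← pullback_sub, hextDeriv, hboundary B hBA hpB] using hclose B hBA hpB hlong hratio

variable {n : ℕ} {U : Set (Eucl n)} {ω : Form (Eucl n) m} {x₀ : Eucl n}

theorem isFluxDerivAt_extDeriv (hflux : FluxIntegrableAt U ω x₀)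
    (hdiff : DifferentiableAt ℝ ω x₀) : IsFluxDerivAt U ω x₀ (extDeriv ω x₀) := by
  refine ⟨hflux, fun v A φ p hparam hv => ?_⟩
  obtain rfl : fderiv ℝ φ p ∘ stdFrame (m + 1) = v := funext hv
  obtain rfl : φ p = x₀ := hparam.map_eq
  exact blockTendsto_boundaryIntegral_pullback hparam.isOpen hparam.contDiffOn hparam.mem
    (hflux A φ p hparam) hdiff

theorem exists_isParamAt_fderiv_single_eq (hU : U ∈ 𝓝 x₀) (v : Fin (m + 1) → Eucl n) :
    ∃ A φ p, IsParamAt U x₀ A φ p ∧ ∀ i, fderiv ℝ φ p (Pi.single i 1) = v i := by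
  let T : (Fin (m + 1) → ℝ) →L[ℝ] Eucl n :=
    ∑ i, (ContinuousLinearMap.proj i : (Fin (m + 1) → ℝ) →L[ℝ] ℝ).smulRight (v i)
  let φ : (Fin (m + 1) → ℝ) → Eucl n := fun t => x₀ + T t
  have hφ : ContDiff ℝ 1 φ := contDiff_const.add T.contDiff
  have hφ_zero : φ 0 = x₀ := by simp [φ]
  refine ⟨φ ⁻¹' interior U, φ, 0, ⟨isOpen_interior.preimage hφ.continuous, hφ.contDiffOn,
    fun t ht => interior_subset ht, ?_, hφ_zero⟩, fun i => ?_⟩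
  · rwa [mem_preimage, hφ_zero, mem_interior_iff_mem_nhds]
  · rw [(T.hasFDerivAt.const_add x₀).fderiv]
    simp [T, Pi.single_apply]

theorem IsFluxDerivAt.unique (hU : U ∈ 𝓝 x₀) {η η' : Eucl n [⋀^Fin (m + 1)]→L[ℝ] ℝ}
    (h : IsFluxDerivAt U ω x₀ η) (h' : IsFluxDerivAt U ω x₀ η') : η = η' := by
  ext v
  obtain ⟨A, φ, p, hparam, hv⟩ := exists_isParamAt_fderiv_single_eq hU v
  exact BlockTendsto.unique (hparam.isOpen.mem_nhds hparam.mem) (h.2 v A φ p hparam hv)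
    (h'.2 v A φ p hparam hv)

end FluxDerivative

end Flux

/-- With `k = m + 1`: a `(k-1)`-form `ω` on an open `U ⊆ ℝⁿ` that is flux-integrable around `x₀` and
differentiable at `x₀` is derivable at `x₀`, and its one and only exterior derivative in the flux
sense is the usual `dω_{x₀}`. -/
theorem mainTheorem3 (n m : ℕ) (U : Set (Flux.Eucl n)) (hU : IsOpen U)
    (ω : Flux.Form (Flux.Eucl n) m) (x₀ : Flux.Eucl n) (hx₀ : x₀ ∈ U)
    (hflux : Flux.FluxIntegrableAt U ω x₀)
    (hdiff : DifferentiableAt ℝ ω x₀) :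
    Flux.DerivableAt U ω x₀ ∧
      ∀ η : Flux.Eucl n [⋀^Fin (m + 1)]→L[ℝ] ℝ,
        Flux.IsFluxDerivAt U ω x₀ η ↔ η = extDeriv ω x₀ := by
  have hd : Flux.IsFluxDerivAt U ω x₀ (extDeriv ω x₀) := Flux.isFluxDerivAt_extDeriv hflux hdiff
  exact ⟨⟨_, hd⟩, fun η => ⟨fun h => h.unique (hU.mem_nhds hx₀) hd, fun h => h ▸ hd⟩⟩
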